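/- Let $R$ be a commutative ring with unity which is not arithmetic, i.e. for some maximal ideal $Q$ of $R$ the ideals of the localization $R_Q$ are not totally ordered by inclusion. Then there exists a pure-injective $R$-module which is not RD-injective. More precisely, there exist a maximal ideal $P$ of $R$ and two elements $a,b\in P$ such that, $E_R(R/P)$ denoting the injective hull of the $R$-module $R/P$, the module $$S=\{x\in E_R(R/P)\mid ax=0 \text{ and } bx=0\}$$ is pure-injective but not RD-injective. Here a short exact sequence $0\to N\to M\to L\to 0$ of $R$-modules is pure-exact if it remains exact after tensoring with any $R$-module, and RD-exact if $rM\cap N=rN$ for every $r\in R$ (viewing $N$ as a submodule of $M$). An $R$-module $F$ is pure-injective (respectively RD-injective) if for every pure-exact (respectively RD-exact) sequence $0\to N\to M\to L\to 0$ the sequence $0\to \mathrm{Hom}_R(L,F)\to \mathrm{Hom}_R(M,F)\to \mathrm{Hom}_R(N,F)\to 0$ is exact. -/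

import Mathlib

open scoped Pointwise TensorProduct

universe u

/-- A module is uniserial if its submodules are totally ordered by inclusion. -/
def IsUniserial (A M : Type u) [CommRing A] [AddCommGroup M] [Module A M] : Prop :=
  ∀ N N' : Submodule A M, N ≤ N' ∨ N' ≤ N

/-- A commutative ring (possibly with zero divisors) is a valuation ring if it is uniserial as a
module over itself. -/
def IsUniserialRing (A : Type u) [CommRing A] : Prop := IsUniserial A A

/-- A commutative ring is arithmetic if its localization at every maximal ideal is a valuation
ring. -/
def IsArithmeticRing (R : Type u) [CommRing R] : Prop :=
  ∀ (P : Ideal R) [P.IsMaximal], IsUniserialRing (Localization.AtPrime P)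

section ExactSequences

variable {R : Type u} [CommRing R] {N M L : Type u}
  [AddCommGroup N] [Module R N] [AddCommGroup M] [Module R M] [AddCommGroup L] [Module R L]

/-- `0 → N → M → L → 0` is exact. -/
def IsShortExact (f : N →ₗ[R] M) (g : M →ₗ[R] L) : Prop :=
  Function.Injective f ∧ Function.Exact f g ∧ Function.Surjective g

/-- A short exact sequence is pure-exact if it stays exact after tensoring with any module. -/
def IsPureExact (f : N →ₗ[R] M) (g : M →ₗ[R] L) : Prop :=
  IsShortExact f g ∧
    ∀ (X : Type u) [AddCommGroup X] [Module R X], IsShortExact (f.lTensor X) (g.lTensor X)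

/-- `F` is an RD-submodule (relatively divisible) of `M` if `rM ∩ F = rF` for every `r`. -/
def IsRDSubmodule (F : Submodule R M) : Prop :=
  ∀ r : R, r • (⊤ : Submodule R M) ⊓ F = r • F

/-- A short exact sequence is RD-exact if its left term is an RD-submodule of the middle term. -/
def IsRDExact (f : N →ₗ[R] M) (g : M →ₗ[R] L) : Prop :=
  IsShortExact f g ∧ IsRDSubmodule (LinearMap.range f)

end ExactSequences

section Injectivity

variable (R : Type u) [CommRing R] (F : Type u) [AddCommGroup F] [Module R F]

/-- `F` is pure-injective if `Hom(-, F)` sends pure-exact sequences to short exact sequences. -/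
def IsPureInjective : Prop :=
  ∀ (N M L : Type u) [AddCommGroup N] [Module R N] [AddCommGroup M] [Module R M]
    [AddCommGroup L] [Module R L] (f : N →ₗ[R] M) (g : M →ₗ[R] L),
    IsPureExact f g → IsShortExact (g.lcomp R F) (f.lcomp R F)

/-- `F` is RD-injective if `Hom(-, F)` sends RD-exact sequences to short exact sequences. -/
def IsRDInjective : Prop :=
  ∀ (N M L : Type u) [AddCommGroup N] [Module R N] [AddCommGroup M] [Module R M]
    [AddCommGroup L] [Module R L] (f : N →ₗ[R] M) (g : M →ₗ[R] L),
    IsRDExact f g → IsShortExact (g.lcomp R F) (f.lcomp R F)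

end Injectivity

section Hull

variable {R : Type u} [CommRing R] {M E : Type u}
  [AddCommGroup M] [Module R M] [AddCommGroup E] [Module R E]

/-- `i : M → E` is an injective hull of `M`: an essential embedding into an injective module. -/
def IsInjectiveHull (i : M →ₗ[R] E) : Prop :=
  Function.Injective i ∧ Module.Injective R E ∧
    ∀ K : Submodule R E, K ⊓ LinearMap.range i = ⊥ → K = ⊥

/-- The submodule `{x ∈ E | a x = 0 and b x = 0}`. -/
def commonAnnihilated (E : Type u) [AddCommGroup E] [Module R E] (a b : R) : Submodule R E :=
  Submodule.torsionBy R E a ⊓ Submodule.torsionBy R E b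

end Hull

section InjectiveHull

variable {R : Type u} [CommRing R]

theorem Submodule.exists_le_maximal_disjoint {J : Type u} [AddCommGroup J] [Module R J]
    (A B : Submodule R J) (h : Disjoint A B) :
    ∃ C, B ≤ C ∧ Maximal (fun X => Disjoint A X) C := by
  refine zorn_le_nonempty₀ {X | Disjoint A X} (fun c hc hchain y hy => ⟨sSup c, ?_, ?_⟩) B h
  · rw [Set.mem_ofPred_eq, Submodule.disjoint_def]
    intro x hxA hx
    obtain ⟨Y, hY, hxY⟩ := (Submodule.mem_sSup_of_directed ⟨y, hy⟩ hchain.directedOn).1 hx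
    exact Submodule.disjoint_def.1 (hc hY) x hxA hxY
  · exact fun z hz => le_sSup hz

theorem Module.exists_injective_embedding (M : Type u) [AddCommGroup M] [Module R M] :
    ∃ (J : Type u) (_ : AddCommGroup J) (_ : Module R J) (i : M →ₗ[R] J),
      Function.Injective i ∧ Module.Injective R J := by
  obtain ⟨J, hJ, f, hf⟩ := CategoryTheory.EnoughInjectives.presentation (ModuleCat.of R M)
  exact ⟨J, inferInstance, inferInstance, f.hom, (ModuleCat.mono_iff_injective f).1 hf,
    (Module.injective_iff_injective_object R J).2 hJ⟩

theorem Module.Injective.of_retract {J E : Type u} [AddCommGroup J] [Module R J]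
    [AddCommGroup E] [Module R E] (hJ : Module.Injective R J) (j : E →ₗ[R] J) (p : J →ₗ[R] E)
    (hp : ∀ e, p (j e) = e) : Module.Injective R E where
  out X Y _ _ _ _ f hf g := by
    obtain ⟨h, hh⟩ := hJ.out f hf (j ∘ₗ g)
    exact ⟨p ∘ₗ h, fun x => by simp [hh, hp]⟩

/-- Every submodule `W` of an injective module `J` has an essential extension inside `J` that is a
retract of `J`. -/
theorem Submodule.exists_essential_retract {J : Type u} [AddCommGroup J] [Module R J]
    (hJ : Module.Injective R J) (W : Submodule R J) :
    ∃ E : Submodule R J, W ≤ E ∧ (∀ K ≤ E, Disjoint W K → K = ⊥) ∧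
      ∃ p : J →ₗ[R] E, ∀ e : E, p e = e := by
  obtain ⟨C, -, hC⟩ := W.exists_le_maximal_disjoint ⊥ disjoint_bot_right
  obtain ⟨E, hWE, hE⟩ := C.exists_le_maximal_disjoint W hC.prop.symm
  have hCE := Submodule.disjoint_def.1 hE.prop
  have hinj : Function.Injective (C.mkQ ∘ₗ E.subtype) := by
    rw [← LinearMap.ker_eq_bot, LinearMap.ker_eq_bot']
    intro e he
    exact Subtype.ext (hCE e (by simpa using he) e.2)
  obtain ⟨h, hh⟩ := hJ.out _ hinj E.subtype
  have hpE : ∀ e ∈ E, h (C.mkQ e) = e := fun e he => hh ⟨e, he⟩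
  have hpC : ∀ c ∈ C, h (C.mkQ c) = 0 := fun c hc => by
    simp [(Submodule.Quotient.mk_eq_zero C).2 hc]
  -- a submodule of the range of the projection that misses `E` has preimage `C`
  have hmiss : ∀ K : Submodule R J, K ≤ LinearMap.range (h ∘ₗ C.mkQ) → Disjoint E K → K = ⊥ := by
    intro K hK hEK
    have hle : C ≤ K.comap (h ∘ₗ C.mkQ) := fun c hc => by
      simp only [Submodule.mem_comap, LinearMap.comp_apply, hpC c hc, K.zero_mem]
    have hdis : Disjoint W (K.comap (h ∘ₗ C.mkQ)) := by
      rw [Submodule.disjoint_def]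
      intro w hw hwK
      rw [Submodule.mem_comap, LinearMap.comp_apply, hpE w (hWE hw)] at hwK
      exact Submodule.disjoint_def.1 hEK w (hWE hw) hwK
    have hle' := hC.le_of_ge hdis hle
    rw [eq_bot_iff]
    intro k hk
    obtain ⟨j, rfl⟩ := hK hk
    exact hpC j (hle' hk)
  have hrange : LinearMap.range (h ∘ₗ C.mkQ) ≤ E := by
    refine hE.le_of_ge ?_ fun e he => ⟨e, hpE e he⟩
    rw [disjoint_iff, inf_comm]
    refine hmiss _ inf_le_left ?_
    exact hE.prop.symm.mono_right inf_le_right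
  refine ⟨E, hWE, fun K hK hWK => ?_, (h ∘ₗ C.mkQ).codRestrict E fun j => hrange ⟨j, rfl⟩,
    fun e => Subtype.ext (hpE e e.2)⟩
  have hdis : Disjoint W (C ⊔ K) := by
    rw [Submodule.disjoint_def]
    intro w hw hwCK
    obtain ⟨c, hc, k, hk, rfl⟩ := Submodule.mem_sup.1 hwCK
    have hc0 : c = 0 := hCE c hc (by simpa using E.sub_mem (hWE hw) (hK hk))
    subst hc0
    rw [zero_add] at hw ⊢
    exact Submodule.disjoint_def.1 hWK k hw hk
  have hKC : K ≤ C := le_sup_right.trans (hC.le_of_ge hdis le_sup_left)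
  exact eq_bot_iff.2 fun k hk => hCE k (hKC hk) (hK hk)

theorem exists_isInjectiveHull (M : Type u) [AddCommGroup M] [Module R M] :
    ∃ (E : Type u) (_ : AddCommGroup E) (_ : Module R E) (i : M →ₗ[R] E), IsInjectiveHull i := by
  obtain ⟨J, _, _, i, hi, hJ⟩ := Module.exists_injective_embedding (R := R) M
  obtain ⟨E, hWE, hess, p, hp⟩ := (LinearMap.range i).exists_essential_retract hJ
  refine ⟨E, inferInstance, inferInstance, i.codRestrict E fun m => hWE ⟨m, rfl⟩,
    fun x y hxy => hi (congrArg Subtype.val hxy), hJ.of_retract E.subtype p hp, fun K hK => ?_⟩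
  have hbot : K.map E.subtype = ⊥ := by
    refine hess _ (Submodule.map_subtype_le E K) ?_
    rw [Submodule.disjoint_def]
    rintro _ ⟨m, rfl⟩ ⟨k, hk, hkm⟩
    have hk0 : k ∈ K ⊓ LinearMap.range (i.codRestrict E fun m => hWE ⟨m, rfl⟩) :=
      ⟨hk, m, Subtype.ext hkm.symm⟩
    rw [hK, Submodule.mem_bot] at hk0
    rw [← hkm, hk0, map_zero]
  exact Submodule.map_injective_of_injective E.injective_subtype (by rw [hbot, Submodule.map_bot])

end InjectiveHull

section PureInjective

variable {R : Type u} [CommRing R]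

theorem mem_commonAnnihilated {E : Type u} [AddCommGroup E] [Module R E] {a b : R} {x : E} :
    x ∈ commonAnnihilated E a b ↔ a • x = 0 ∧ b • x = 0 := by
  simp [commonAnnihilated]

theorem isShortExact_lcomp_of_surjective {N M L F : Type u} [AddCommGroup N] [Module R N]
    [AddCommGroup M] [Module R M] [AddCommGroup L] [Module R L] [AddCommGroup F] [Module R F]
    {f : N →ₗ[R] M} {g : M →ₗ[R] L} (h : IsShortExact f g)
    (hs : Function.Surjective (f.lcomp R F)) : IsShortExact (g.lcomp R F) (f.lcomp R F) :=
  ⟨LinearMap.lcomp_injective_of_surjective g h.2.2,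
    LinearMap.exact_lcomp_of_exact_of_surjective F h.2.1 h.2.2, hs⟩

theorem isPureInjective_commonAnnihilated {E : Type u} [AddCommGroup E] [Module R E]
    (hE : Module.Injective R E) (a b : R) : IsPureInjective R (commonAnnihilated E a b) := by
  intro N M L _ _ _ _ _ _ f g hfg
  refine isShortExact_lcomp_of_surjective hfg.1 fun φ => ?_
  let I : Ideal R := Ideal.span {a, b}
  have ha : a ∈ I := Ideal.subset_span (by simp)
  have hb : b ∈ I := Ideal.subset_span (by simp)
  let φ' : N →ₗ[R] E := (commonAnnihilated E a b).subtype ∘ₗ φ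
  have hφ : I ≤ LinearMap.ker (LinearMap.toSpanSingleton R (N →ₗ[R] E) φ') := by
    rw [Ideal.span_le]
    rintro r (rfl | rfl)
    · exact LinearMap.ext fun n => (mem_commonAnnihilated.1 (φ n).2).1
    · exact LinearMap.ext fun n => (mem_commonAnnihilated.1 (φ n).2).2
  obtain ⟨ψ, hψ⟩ := hE.out (f.lTensor (R ⧸ I)) (hfg.2 (R ⧸ I)).1
    (TensorProduct.lift (Submodule.liftQ I _ hφ))
  let ψ' : M →ₗ[R] E := ψ ∘ₗ TensorProduct.mk R (R ⧸ I) M 1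
  have hkill : ∀ r ∈ I, ∀ m, r • ψ' m = 0 := fun r hr m => by
    have h1 : r • (1 : R ⧸ I) = 0 := by
      rw [Algebra.smul_def, mul_one]
      exact Ideal.Quotient.eq_zero_iff_mem.2 hr
    rw [← map_smul]
    simp only [ψ', LinearMap.comp_apply, map_smul, TensorProduct.mk_apply]
    rw [← map_smul, TensorProduct.smul_tmul', h1, TensorProduct.zero_tmul, map_zero]
  refine ⟨ψ'.codRestrict _ fun m => mem_commonAnnihilated.2 ⟨hkill a ha m, hkill b hb m⟩, ?_⟩
  ext n
  have key := hψ (1 ⊗ₜ n)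
  rw [LinearMap.lTensor_tmul, TensorProduct.lift.tmul] at key
  refine key.trans ?_
  change ((1 : R) • φ') n = _
  rw [one_smul]
  rfl

end PureInjective

section NotRDInjective

variable {R : Type u} [CommRing R]

/-- The elements `a` and `b` generate incomparable ideals in the localization at `P`. -/
def LocallyIncomparable (P : Ideal R) (a b : R) : Prop :=
  ∀ u c, (u * a = c * b → u ∈ P) ∧ (u * b = c * a → u ∈ P)

theorem exists_locallyIncomparable (hR : ¬ IsArithmeticRing R) :
    ∃ P : Ideal R, P.IsMaximal ∧ ∃ a b, LocallyIncomparable P a b := by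
  simp only [IsArithmeticRing, IsUniserialRing, IsUniserial, not_forall, not_or] at hR
  obtain ⟨P, hP, N, N', hN, hN'⟩ := hR
  obtain ⟨x, hx, hx'⟩ := SetLike.not_le_iff_exists.1 hN
  obtain ⟨y, hy', hy⟩ := SetLike.not_le_iff_exists.1 hN'
  have key : ∀ (K : Ideal (Localization.AtPrime P)) (a b : R) (s t : P.primeCompl),
      IsLocalization.mk' (Localization.AtPrime P) a s ∉ K →
      IsLocalization.mk' (Localization.AtPrime P) b t ∈ K → ∀ u c, u * a = c * b → u ∈ P := by
    intro K a b s t ha hb u c huc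
    by_contra hu
    refine ha ?_
    have := K.mul_mem_left (IsLocalization.mk' (Localization.AtPrime P) (c * t) (⟨u, hu⟩ * s)) hb
    rw [← IsLocalization.mk'_mul] at this
    convert this using 1
    rw [IsLocalization.mk'_eq_iff_eq]
    congr 1
    push_cast
    linear_combination (s * t : R) * huc
  obtain ⟨a, s, rfl⟩ := IsLocalization.exists_mk'_eq P.primeCompl x
  obtain ⟨b, t, rfl⟩ := IsLocalization.exists_mk'_eq P.primeCompl y
  exact ⟨P, hP, a, b, fun u c => ⟨key N' a b s t hx' hy' u c, key N b a t s hy hx u c⟩⟩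

namespace LocallyIncomparable

variable {P : Ideal R} {a b : R}

theorem left_mem (h : LocallyIncomparable P a b) : a ∈ P := (h a b).2 (mul_comm a b)

theorem right_mem (h : LocallyIncomparable P a b) : b ∈ P := (h b a).1 (mul_comm b a)

theorem mul_mem [hP : P.IsPrime] (h : LocallyIncomparable P a b) {r x y s c : R}
    (hx : r * x = s * a) (hy : r * y = s * b) (hc : r * c ∈ Ideal.span {a, b}) :
    c * s ∈ P := by
  by_contra hcs
  obtain ⟨α, β, hαβ⟩ := Ideal.mem_span_pair.1 hc
  have h1 : c * s - x * α ∈ P := (h _ (x * β)).1 (by linear_combination (-c) * hx - x * hαβ)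
  have h2 : c * s - y * β ∈ P := (h _ (y * α)).2 (by linear_combination (-c) * hy - y * hαβ)
  have hyP : y ∉ P := fun hyP => hcs (by simpa using P.add_mem h2 (P.mul_mem_right β hyP))
  have hsP : s ∉ P := fun hsP => hcs (P.mul_mem_left c hsP)
  have h3 : y * s ∈ P := (h _ (x * s)).1 (by linear_combination x * hy - y * hx)
  exact (hP.mem_or_mem h3).elim hyP hsP

end LocallyIncomparable

/-- Triples `(r, x, y)` for which `r` annihilates the class of `(x, y)` in `R² / R (a, b)`. -/
def AnnihilatorIndex (a b : R) : Type u :=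
  {i : R × R × R // ∃ s, i.1 * i.2.1 = s * a ∧ i.1 * i.2.2 = s * b}

namespace AnnihilatorIndex

variable (a b : R)

/-- The map `⨁ R → R²` with value `(x, y)` at the basis vector indexed by `(r, x, y)`. -/
noncomputable def toPair : (AnnihilatorIndex a b →₀ R) →ₗ[R] R × R :=
  Finsupp.linearCombination R fun i => i.1.2

/-- The relations that make the basis vector indexed by `(r, x, y)` annihilated by `r`. -/
def relations : Submodule R (AnnihilatorIndex a b →₀ R) where
  carrier := {v | ∀ i, ∃ c, v i = i.1.1 * c}
  zero_mem' i := ⟨0, by simp⟩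
  add_mem' {v w} hv hw i := by
    obtain ⟨c, hc⟩ := hv i
    obtain ⟨d, hd⟩ := hw i
    exact ⟨c + d, by rw [Finsupp.add_apply, hc, hd, mul_add]⟩
  smul_mem' t v hv i := by
    obtain ⟨c, hc⟩ := hv i
    exact ⟨t * c, by rw [Finsupp.smul_apply, hc, smul_eq_mul]; ring⟩

/-- The direct sum of the modules `R / r R` over all indices `(r, x, y)`. -/
abbrev Cover : Type u := (AnnihilatorIndex a b →₀ R) ⧸ relations a b

theorem toPair_mem_of_mem_relations {J : Ideal R} {v : AnnihilatorIndex a b →₀ R}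
    (hv : v ∈ relations a b)
    (hJ : ∀ (i : AnnihilatorIndex a b) (s c : R), i.1.1 * i.1.2.1 = s * a →
      i.1.1 * i.1.2.2 = s * b → v i = i.1.1 * c → c * s ∈ J) :
    ∃ t ∈ J, toPair a b v = t • (a, b) := by
  choose s hs using fun i : AnnihilatorIndex a b => i.2
  choose c hc using hv
  refine ⟨∑ i ∈ v.support, c i * s i,
    J.sum_mem fun i _ => hJ i (s i) (c i) (hs i).1 (hs i).2 (hc i), ?_⟩
  rw [toPair, Finsupp.linearCombination_apply, Finsupp.sum, Finset.sum_smul]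
  refine Finset.sum_congr rfl fun i _ => Prod.ext ?_ ?_
  · simp only [Prod.smul_fst, smul_eq_mul]
    linear_combination i.1.2.1 * hc i + c i * (hs i).1
  · simp only [Prod.smul_snd, smul_eq_mul]
    linear_combination i.1.2.2 * hc i + c i * (hs i).2

/-- The canonical map from the cover to `R² / R (a, b)`. -/
noncomputable def coverMap : Cover a b →ₗ[R] (R × R) ⧸ Submodule.span R {(a, b)} :=
  (relations a b).liftQ ((Submodule.mkQ _) ∘ₗ toPair a b) fun v hv => by
    obtain ⟨t, -, ht⟩ := toPair_mem_of_mem_relations a b (J := ⊤) hv fun _ _ _ _ _ _ => trivial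
    rw [LinearMap.mem_ker, LinearMap.comp_apply, Submodule.mkQ_apply,
      Submodule.Quotient.mk_eq_zero, ht]
    exact Submodule.smul_mem _ t (Submodule.mem_span_singleton_self _)

variable {a b}

theorem coverMap_mk (v : AnnihilatorIndex a b →₀ R) :
    coverMap a b (Submodule.Quotient.mk v) = Submodule.Quotient.mk (toPair a b v) := rfl

theorem mk_mem_ker_coverMap {v : AnnihilatorIndex a b →₀ R} :
    (Submodule.Quotient.mk v : Cover a b) ∈ LinearMap.ker (coverMap a b) ↔
      ∃ t : R, t • (a, b) = toPair a b v := by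
  rw [LinearMap.mem_ker, coverMap_mk, Submodule.Quotient.mk_eq_zero,
    Submodule.mem_span_singleton]

/-- The basis vector of the cover indexed by `i`. -/
noncomputable def gen (i : AnnihilatorIndex a b) : Cover a b :=
  Submodule.Quotient.mk (Finsupp.single i 1)

theorem toPair_single (i : AnnihilatorIndex a b) (t : R) :
    toPair a b (Finsupp.single i t) = t • i.1.2 := by
  simp [toPair]

theorem smul_gen (i : AnnihilatorIndex a b) : i.1.1 • gen i = 0 := by
  rw [gen, ← Submodule.Quotient.mk_smul, Submodule.Quotient.mk_eq_zero]
  classical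
  intro j
  by_cases hij : i = j
  · subst hij
    exact ⟨1, by simp⟩
  · exact ⟨0, by simp [hij]⟩

theorem coverMap_gen (i : AnnihilatorIndex a b) :
    coverMap a b (gen i) = Submodule.Quotient.mk i.1.2 := by
  rw [gen, coverMap_mk, toPair_single, one_smul]

theorem exists_gen (r : R) (l : (R × R) ⧸ Submodule.span R {(a, b)}) (h : r • l = 0) :
    ∃ m : Cover a b, r • m = 0 ∧ coverMap a b m = l := by
  obtain ⟨⟨x, y⟩, rfl⟩ := Submodule.Quotient.mk_surjective _ l
  rw [← Submodule.Quotient.mk_smul, Submodule.Quotient.mk_eq_zero,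
    Submodule.mem_span_singleton] at h
  obtain ⟨s, hs⟩ := h
  let i : AnnihilatorIndex a b :=
    ⟨(r, x, y), s, (congrArg Prod.fst hs).symm, (congrArg Prod.snd hs).symm⟩
  exact ⟨gen i, smul_gen i, coverMap_gen i⟩

theorem isRDExact_coverMap :
    IsRDExact (LinearMap.ker (coverMap a b)).subtype (coverMap a b) := by
  refine ⟨⟨Submodule.injective_subtype _, ?_, fun l => ?_⟩, fun r => ?_⟩
  · exact LinearMap.exact_subtype_ker_map _
  · obtain ⟨m, -, hm⟩ := exists_gen 0 l (zero_smul _ _)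
    exact ⟨m, hm⟩
  · rw [Submodule.range_subtype]
    refine le_antisymm ?_ (le_inf (Submodule.map_mono le_top) ?_)
    · rintro _ ⟨⟨m, -, rfl⟩, hm⟩
      have hm' : r • coverMap a b m = 0 := (map_smul (coverMap a b) r m).symm.trans hm
      obtain ⟨m', hm0, hmm⟩ := exists_gen r _ hm'
      refine ⟨m - m', ?_, ?_⟩
      · simp [hmm]
      · change r • (m - m') = r • m
        rw [smul_sub, hm0, sub_zero]
    · rintro _ ⟨m, hm, rfl⟩
      exact Submodule.smul_mem _ r hm

variable (a b)

/-- The indices of the generators of the cover that lift the standard basis of `R²`. -/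
def basisIndex (x y : R) : AnnihilatorIndex a b := ⟨(0, x, y), 0, by simp, by simp⟩

/-- The element `a e₁ + b e₂` of the kernel of the cover. -/
noncomputable def relator : LinearMap.ker (coverMap a b) :=
  ⟨a • gen (basisIndex a b 1 0) + b • gen (basisIndex a b 0 1), by
    rw [LinearMap.mem_ker, map_add, map_smul, map_smul, coverMap_gen, coverMap_gen,
      ← Submodule.Quotient.mk_smul, ← Submodule.Quotient.mk_smul, ← Submodule.Quotient.mk_add,
      Submodule.Quotient.mk_eq_zero, Submodule.mem_span_singleton]
    exact ⟨1, by simp [basisIndex]⟩⟩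

variable {a b}

theorem mem_of_smul_relator {P : Ideal R} [hP : P.IsPrime] (h : LocallyIncomparable P a b)
    {u : R} {n₁ n₂ : LinearMap.ker (coverMap a b)}
    (hu : u • relator a b = a • n₁ + b • n₂) : u ∈ P := by
  classical
  obtain ⟨n₁, hn₁⟩ := n₁
  obtain ⟨n₂, hn₂⟩ := n₂
  obtain ⟨f₁, rfl⟩ := Submodule.Quotient.mk_surjective _ n₁
  obtain ⟨f₂, rfl⟩ := Submodule.Quotient.mk_surjective _ n₂
  obtain ⟨t₁, ht₁⟩ := mk_mem_ker_coverMap.1 hn₁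
  obtain ⟨t₂, ht₂⟩ := mk_mem_ker_coverMap.1 hn₂
  set e₁ : AnnihilatorIndex a b →₀ R := Finsupp.single (basisIndex a b 1 0) 1 with he₁
  set e₂ : AnnihilatorIndex a b →₀ R := Finsupp.single (basisIndex a b 0 1) 1 with he₂
  have hmem : u • (a • e₁ + b • e₂) - (a • f₁ + b • f₂) ∈ relations a b :=
    (Submodule.Quotient.eq _).1 (congrArg Subtype.val hu)
  obtain ⟨t, ht, hpair⟩ := toPair_mem_of_mem_relations a b (J := P) hmem
    fun i s c hx hy hi => h.mul_mem hx hy (by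
      rw [← hi, Ideal.mem_span_pair]
      exact ⟨u * e₁ i - f₁ i, u * e₂ i - f₂ i, by
        simp only [Finsupp.sub_apply, Finsupp.add_apply, Finsupp.smul_apply, smul_eq_mul]
        ring⟩)
  rw [map_sub, map_smul, map_add, map_add, map_smul, map_smul, map_smul, map_smul, ← ht₁, ← ht₂,
    he₁, he₂, toPair_single, toPair_single] at hpair
  have hfst := congrArg Prod.fst hpair
  simp only [basisIndex, Prod.fst_sub, Prod.fst_add, Prod.smul_fst, smul_eq_mul] at hfst
  have hmemP : u - (a * t₁ + b * t₂) - t ∈ P := (h _ 0).1 (by linear_combination hfst)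
  have hab : a * t₁ + b * t₂ ∈ P :=
    P.add_mem (P.mul_mem_right _ h.left_mem) (P.mul_mem_right _ h.right_mem)
  have := P.add_mem (P.add_mem hmemP ht) hab
  simpa using this

end AnnihilatorIndex

open AnnihilatorIndex in
theorem not_isRDInjective_commonAnnihilated {P : Ideal R} [hP : P.IsPrime] {a b : R}
    (h : LocallyIncomparable P a b) {E : Type u} [AddCommGroup E] [Module R E]
    (hE : Module.Injective R E) (i : (R ⧸ P) →ₗ[R] E) (hi : Function.Injective i) :
    ¬ IsRDInjective R (commonAnnihilated E a b) := by
  intro hRD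
  let N := LinearMap.ker (coverMap a b)
  let D : Submodule R N := LinearMap.range
    ((LinearMap.lsmul R N a).coprod (LinearMap.lsmul R N b))
  have hD : ∀ n₁ n₂ : N, a • n₁ + b • n₂ ∈ D := fun n₁ n₂ => ⟨(n₁, n₂), rfl⟩
  let q : R →ₗ[R] N ⧸ D := LinearMap.toSpanSingleton R _ (D.mkQ (relator a b))
  have hq : LinearMap.ker q ≤ LinearMap.ker (Submodule.mkQ P) := by
    intro u hu
    rw [Submodule.ker_mkQ]
    have hu' : u • relator a b ∈ D := by
      rw [← Submodule.Quotient.mk_eq_zero]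
      exact hu
    obtain ⟨⟨n₁, n₂⟩, hn⟩ := hu'
    exact mem_of_smul_relator h hn.symm
  let q' : (R ⧸ LinearMap.ker q) →ₗ[R] N ⧸ D := (LinearMap.ker q).liftQ q le_rfl
  have hq' : Function.Injective q' := by
    rw [← LinearMap.ker_eq_bot]
    exact Submodule.ker_liftQ_eq_bot _ _ _ le_rfl
  obtain ⟨φ, hφ⟩ := hE.out q' hq' (i ∘ₗ (LinearMap.ker q).liftQ (Submodule.mkQ P) hq)
  have hφ1 : φ (D.mkQ (relator a b)) = i 1 := by
    have := hφ (Submodule.Quotient.mk 1)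
    simp only [q', LinearMap.comp_apply, Submodule.liftQ_apply, q,
      LinearMap.toSpanSingleton_apply, one_smul] at this
    exact this
  have hkill : ∀ n : N, a • φ (D.mkQ n) = 0 ∧ b • φ (D.mkQ n) = 0 := fun n => by
    rw [← map_smul, ← map_smul, ← map_smul, ← map_smul, Submodule.mkQ_apply, Submodule.mkQ_apply,
      (Submodule.Quotient.mk_eq_zero D).2 (by simpa using hD n 0),
      (Submodule.Quotient.mk_eq_zero D).2 (by simpa using hD 0 n), map_zero]
    exact ⟨rfl, rfl⟩
  obtain ⟨ψ, hψ⟩ := (hRD N _ _ N.subtype (coverMap a b) isRDExact_coverMap).2.2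
    ((φ ∘ₗ D.mkQ).codRestrict (commonAnnihilated E a b) fun n =>
      mem_commonAnnihilated.2 (hkill n))
  have hval : ((ψ (relator a b : Cover a b) : commonAnnihilated E a b) : E) = i 1 :=
    (congrArg Subtype.val (LinearMap.congr_fun hψ (relator a b))).trans hφ1
  have hzero : ((ψ (relator a b : Cover a b) : commonAnnihilated E a b) : E) = 0 := by
    simp only [relator, map_add, map_smul, Submodule.coe_add, Submodule.coe_smul]
    rw [(mem_commonAnnihilated.1 (ψ _).2).1, (mem_commonAnnihilated.1 (ψ _).2).2, add_zero]
  have h1 : (1 : R ⧸ P) = 0 := hi (by rw [← hval, hzero, map_zero])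
  exact hP.ne_top ((Ideal.eq_top_iff_one P).2 (Ideal.Quotient.eq_zero_iff_mem.1 h1))

end NotRDInjective

theorem mainTheorem4 (R : Type u) [CommRing R] (hR : ¬ IsArithmeticRing R) :
    (∃ (F : Type u) (_ : AddCommGroup F) (_ : Module R F),
      IsPureInjective R F ∧ ¬ IsRDInjective R F) ∧
    ∃ P : Ideal R, P.IsMaximal ∧ ∃ a ∈ P, ∃ b ∈ P,
      (∃ (E : Type u) (_ : AddCommGroup E) (_ : Module R E) (i : (R ⧸ P) →ₗ[R] E),
        IsInjectiveHull i) ∧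
      ∀ (E : Type u) [AddCommGroup E] [Module R E] (i : (R ⧸ P) →ₗ[R] E), IsInjectiveHull i →
        IsPureInjective R (commonAnnihilated E a b) ∧
        ¬ IsRDInjective R (commonAnnihilated E a b) := by
  obtain ⟨P, hP, a, b, h⟩ := exists_locallyIncomparable hR
  have main : ∀ (E : Type u) [AddCommGroup E] [Module R E] (i : (R ⧸ P) →ₗ[R] E),
      IsInjectiveHull i → IsPureInjective R (commonAnnihilated E a b) ∧
        ¬ IsRDInjective R (commonAnnihilated E a b) := fun E _ _ i hi =>
    ⟨isPureInjective_commonAnnihilated hi.2.1 a b,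
      not_isRDInjective_commonAnnihilated h hi.2.1 i hi.1⟩
  obtain ⟨E, iE, iM, i, hi⟩ := exists_isInjectiveHull (R := R) (R ⧸ P)
  exact ⟨⟨commonAnnihilated E a b, inferInstance, inferInstance, main E i hi⟩,
    P, hP, a, h.left_mem, b, h.right_mem, ⟨E, iE, iM, i, hi⟩, main⟩
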